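/- Let $\mathbf X$ be a measurable space, $\mathbf A$ a (standard) Borel space, $\mathbf A(x)\subseteq\mathbf A$ $(x\in\mathbf X)$ nonempty sets such that $\mathbf K=\{(x,a): a\in\mathbf A(x)\}$ is measurable in $\mathbf X\times\mathbf A$, $Q$ a stochastic kernel on $\mathbf X$ given $\mathbf X\times\mathbf A$, $\eta$ a probability measure on $\mathbf X$ and $\Delta\subseteq\mathbf X$ measurable. Let $\mathbf M$ be the set of stochastic kernels $\sigma$ on $\mathbf A$ given $\mathbf X$ with $\sigma(\mathbf A(x)|x)=1$ for all $x$, and assume $\mathbf M\neq\emptyset$. A policy $\pi\in\mathbf\Pi$ is a sequence of stochastic kernels $\pi_n$ on $\mathbf A$ given the histories $h_n=(x_0,a_0,\dots,x_n)$ with $\pi_n(\mathbf A(x_n)|h_n)=1$ for all $h_n$; each $\sigma\in\mathbf M$ is identified with the stationary policy $\pi_n(\cdot|h_n)=\sigma(\cdot|x_n)$. Let $\mathbb P_{\eta,\pi}$ be the law of the state-action process $(X_t,A_t)_{t\ge0}$ on $(\mathbf X\times\mathbf A)^{\infty}$ under $\pi$ with initial distribution $\eta$, and $T_\Delta=\min\{n\ge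 0: X_n\in\Delta\}\in\mathbb N\cup\{\infty\}$. Assume that the model $\mathbf M(\eta,\Delta)$ is absorbing: $Q(\Delta|x,a)=1$ for all $(x,a)\in\Delta\times\mathbf A$, and $\mathbb E_{\eta,\pi}[T_\Delta]<\infty$ for every $\pi\in\mathbf\Pi$. The occupation measure of $\pi$ is $\mu_{\eta,\pi}(\Gamma)=\mathbb E_{\eta,\pi}\big[\sum_{t\ge0}\mathbf 1_{\{T_\Delta>t\}}\mathbf 1_{\{(X_t,A_t)\in\Gamma\}}\big]$, and $\mathcal O_\eta=\{\mu_{\eta,\pi}:\pi\in\mathbf\Pi\}$. For a finite measure $\mu$ on $\mathbf X\times\mathbf A$ write $\mu^{\mathbf X}$ for its marginal on $\mathbf X$ and $\mu Q(B)=\int Q(B|x,a)\,\mu(dx,da)$. Let $\mathcal C_\eta$ be the set of finite (nonnegative) measures $\mu$ on $\mathbf X\times\mathbf A$ that solve the characteristic equations: $\mu(\mathbf K^c)=0$ and $\mu^{\mathbf X}(B)=(\eta+\mu Q)(B\cap\Delta^c)$ for all measurable $B$. A finite measure $\vartheta$ on $\mathbf X\times\mathbf A$ is invariant for $Q\mathbb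 I_{\Delta^c}$ if $\vartheta(\mathbf K^c)=0$ and $\vartheta^{\mathbf X}(B)=\vartheta Q(B\cap\Delta^c)$ for all measurable $B$. For a finite measure $\nu$ on $\mathbf X$ and $\sigma\in\mathbf M$, $(\nu\otimes\sigma)(\Gamma\times\Lambda)=\int_\Gamma\sigma(\Lambda|x)\,\nu(dx)$. (i) A measure $\mu$ on $\mathbf X\times\mathbf A$ is in $\mathcal C_\eta$ if and only if there are $\sigma\in\mathbf M$ and a finite measure $\nu$ on $\mathbf X$ such that $\nu\otimes\sigma$ is invariant for $Q\mathbb I_{\Delta^c}$ and $\mu=\mu_{\eta,\sigma}+\nu\otimes\sigma$. (ii) The following are equivalent: (a) the only invariant measure for $Q\mathbb I_{\Delta^c}$ is the null measure on $\mathbf X\times\mathbf A$; (b) $\mathcal C_\eta=\mathcal O_\eta$, i.e. there are no phantom measures (measures in $\mathcal C_\eta\setminus\mathcal O_\eta$); (c) $\mathcal C_\eta$ is bounded, i.e. $\sup_{\mu\in\mathcal C_\eta}\mu(\mathbf X\times\mathbf A)<\infty$. -/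

import Mathlib

open MeasureTheory ProbabilityTheory
open scoped ENNReal

/-- A stationary Markov control model `M(η, Δ)`: feasible action sets `A(x)`, a stochastic kernel
`Q` on `X` given `X × A`, an initial distribution `η` and a measurable set `Δ`. -/
structure ControlModel (X A : Type*) [MeasurableSpace X] [MeasurableSpace A] where
  /-- The set `A(x)` of actions available in state `x`. -/
  act : X → Set A
  act_nonempty : ∀ x, (act x).Nonempty
  /-- The set `K` of feasible pairs is measurable (hence so is each section `A(x)`). -/
  measurableSet_graph : MeasurableSet {p : X × A | p.2 ∈ act p.1}
  Q : Kernel (X × A) X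
  isMarkovKernel_Q : IsMarkovKernel Q
  η : Measure X
  isProbabilityMeasure_η : IsProbabilityMeasure η
  Δ : Set X
  measurableSet_Δ : MeasurableSet Δ

namespace ControlModel

/-- Histories `h_n = (x_0, a_0, …, x_{n-1}, a_{n-1}, x_n)`: the `n` past state-action pairs and the
current state. -/
abbrev Hist (X A : Type*) (n : ℕ) : Type _ := (Fin n → X × A) × X

variable {X A : Type*} [MeasurableSpace X] [MeasurableSpace A]

attribute [instance] isMarkovKernel_Q isProbabilityMeasure_η

/-- The set `K` of feasible state-action pairs. -/
def graph (M : ControlModel X A) : Set (X × A) := {p | p.2 ∈ M.act p.1}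

/-- The set `Π` of (history-dependent, randomized) control policies. -/
structure Policy (M : ControlModel X A) where
  kernel : ∀ n, Kernel (Hist X A n) A
  isMarkovKernel : ∀ n, IsMarkovKernel (kernel n)
  feasible : ∀ n (h : Hist X A n), kernel n h (M.act h.2) = 1

/-- The set `𝐌` of stochastic kernels `φ` on `A` given `X` with `φ(A(x)|x) = 1` for all `x`. -/
structure FeasibleKernel (M : ControlModel X A) where
  kernel : Kernel X A
  isMarkovKernel : IsMarkovKernel kernel
  feasible : ∀ x, kernel x (M.act x) = 1

attribute [instance] Policy.isMarkovKernel FeasibleKernel.isMarkovKernel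

/-- The stationary randomized policy generated by `φ ∈ 𝐌`: `π_n(·|h_n) = φ(·|x_n)`. -/
def FeasibleKernel.toPolicy {M : ControlModel X A} (φ : M.FeasibleKernel) : M.Policy where
  kernel _ := φ.kernel.comap Prod.snd measurable_snd
  isMarkovKernel _ := inferInstance
  feasible _ h := φ.feasible h.2

/-- The canonical space of sample paths `(x_0, a_0, x_1, a_1, …)`. -/
abbrev Path (X A : Type*) : Type _ := ℕ → X × A

/-- From the state-action pairs at times `0, …, n` and the state at time `n + 1`, the history
`h_{n+1}`. -/
def toHist (n : ℕ) (p : (Finset.Iic n → X × A) × X) : Hist X A (n + 1) :=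
  (fun i ↦ p.1 ⟨i, Finset.mem_Iic.2 (Nat.lt_succ_iff.1 i.2)⟩, p.2)

lemma measurable_toHist (n : ℕ) : Measurable (toHist (X := X) (A := A) n) := by
  unfold toHist
  fun_prop

/-- The conditional law of `(X_{n+1}, A_{n+1})` given the state-action pairs up to time `n`:
`X_{n+1}` is drawn from `Q(·|X_n, A_n)`, and then `A_{n+1}` from `π_{n+1}(·|H_{n+1})`. -/
noncomputable def stepKernel (M : ControlModel X A) (π : M.Policy) (n : ℕ) :
    Kernel (Finset.Iic n → X × A) (X × A) :=
  (M.Q.comap (fun h ↦ h ⟨n, Finset.mem_Iic.2 le_rfl⟩) (measurable_pi_apply _)) ⊗ₖ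
    ((π.kernel (n + 1)).comap (toHist n) (measurable_toHist n))

instance (M : ControlModel X A) (π : M.Policy) (n : ℕ) : IsMarkovKernel (M.stepKernel π n) := by
  unfold stepKernel
  infer_instance

/-- The law of `(X_0, A_0)`. -/
noncomputable def initialLaw (M : ControlModel X A) (π : M.Policy) : Measure (X × A) :=
  M.η ⊗ₘ ((π.kernel 0).comap (fun x ↦ (Fin.elim0, x)) (by fun_prop))

/-- The law `P_{η,π}` of the state-action process, given by the Ionescu-Tulcea theorem. -/
noncomputable def pathLaw (M : ControlModel X A) (π : M.Policy) : Measure (Path X A) :=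
  Kernel.trajMeasure (X := fun _ ↦ X × A) (M.initialLaw π) (M.stepKernel π)

/-- The hitting time of `Δ`; the infimum over the empty set is `⊤`. -/
noncomputable def hittingTime (M : ControlModel X A) (ω : Path X A) : ℕ∞ :=
  ⨅ (n : ℕ) (_ : (ω n).1 ∈ M.Δ), (n : ℕ∞)

/-- `M(η, Δ)` is absorbing: `Q(Δ|x,a) = 1` on `Δ × A`, and the expected hitting time of `Δ` is finite
under every policy. -/
def IsAbsorbing (M : ControlModel X A) : Prop :=
  (∀ x ∈ M.Δ, ∀ a : A, M.Q (x, a) M.Δ = 1) ∧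
    ∀ π : M.Policy, ∫⁻ ω, (M.hittingTime ω : ℝ≥0∞) ∂(M.pathLaw π) < ∞

/-- The occupation measure `μ_{η,π}`; see `occupationMeasure_apply` for its values. -/
noncomputable def occupationMeasure (M : ControlModel X A) (π : M.Policy) : Measure (X × A) :=
  Measure.sum fun t : ℕ ↦
    ((M.pathLaw π).restrict {ω | (t : ℕ∞) < M.hittingTime ω}).map (fun ω ↦ ω t)

lemma lt_hittingTime_iff (M : ControlModel X A) (t : ℕ) (ω : Path X A) :
    (t : ℕ∞) < M.hittingTime ω ↔ ∀ n ≤ t, (ω n).1 ∉ M.Δ := by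
  constructor
  · intro h n hn hmem
    have h1 : M.hittingTime ω ≤ (n : ℕ∞) := iInf₂_le n hmem
    have h2 : (n : ℕ∞) ≤ t := by exact_mod_cast hn
    exact absurd h (not_lt.2 (h1.trans h2))
  · intro h
    have h1 : ((t + 1 : ℕ) : ℕ∞) ≤ M.hittingTime ω := by
      refine le_iInf₂ fun n hn ↦ ?_
      by_contra hlt
      have h2 : n < t + 1 := by exact_mod_cast not_le.1 hlt
      exact h n (Nat.lt_succ_iff.1 h2) hn
    exact lt_of_lt_of_le (by exact_mod_cast Nat.lt_succ_self t) h1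

lemma measurableSet_lt_hittingTime (M : ControlModel X A) (t : ℕ) :
    MeasurableSet {ω : Path X A | (t : ℕ∞) < M.hittingTime ω} := by
  simp only [lt_hittingTime_iff, Set.ofPred_forall]
  refine MeasurableSet.iInter fun n ↦ MeasurableSet.iInter fun _ ↦ ?_
  exact (M.measurableSet_Δ.preimage (measurable_fst.comp (measurable_pi_apply n))).compl

/-- `μ_{η,π}(Γ) = E_{η,π}[∑ₜ 1_{T_Δ > t} 1_{(X_t, A_t) ∈ Γ}]` for measurable `Γ`. -/
lemma occupationMeasure_apply (M : ControlModel X A) (π : M.Policy) {Γ : Set (X × A)}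
    (hΓ : MeasurableSet Γ) :
    M.occupationMeasure π Γ = ∫⁻ ω, ∑' t : ℕ,
      ({ω : Path X A | (t : ℕ∞) < M.hittingTime ω}.indicator (fun _ ↦ (1 : ℝ≥0∞)) ω *
        Γ.indicator (fun _ ↦ (1 : ℝ≥0∞)) (ω t)) ∂(M.pathLaw π) := by
  have hm (t : ℕ) : MeasurableSet ((fun ω : Path X A ↦ ω t) ⁻¹' Γ) :=
    hΓ.preimage (measurable_pi_apply t)
  have hT := M.measurableSet_lt_hittingTime
  have key (t : ℕ) (ω : Path X A) :
      {ω : Path X A | (t : ℕ∞) < M.hittingTime ω}.indicator (fun _ ↦ (1 : ℝ≥0∞)) ω *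
        Γ.indicator (fun _ ↦ (1 : ℝ≥0∞)) (ω t) =
      ((fun ω : Path X A ↦ ω t) ⁻¹' Γ ∩ {ω | (t : ℕ∞) < M.hittingTime ω}).indicator
        (fun _ ↦ (1 : ℝ≥0∞)) ω := by
    by_cases h1 : ω t ∈ Γ <;> by_cases h2 : (t : ℕ∞) < M.hittingTime ω <;> simp [h1, h2]
  simp only [key]
  rw [lintegral_tsum fun t ↦
    (measurable_const.indicator ((hm t).inter (hT t))).aemeasurable]
  rw [occupationMeasure, Measure.sum_apply _ hΓ]
  congr 1 with t
  rw [Measure.map_apply (measurable_pi_apply t) hΓ, Measure.restrict_apply (hm t),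
    lintegral_indicator_const ((hm t).inter (hT t)), one_mul]

/-- The set `O_η` of occupation measures. -/
def occupationMeasures (M : ControlModel X A) : Set (Measure (X × A)) :=
  Set.range M.occupationMeasure

/-- The set `C_η` of solutions of the characteristic equations: the finite measures `μ` with
`μ(Kᶜ) = 0` whose `X`-marginal is the restriction of `η + μQ` to `Δᶜ`. -/
def charSolutions (M : ControlModel X A) : Set (Measure (X × A)) :=
  {μ | IsFiniteMeasure μ ∧ μ M.graphᶜ = 0 ∧ μ.fst = (M.η + M.Q ∘ₘ μ).restrict M.Δᶜ}

/-- `ϑ` is a (finite) invariant measure for the kernel `Q 𝕀_{Δᶜ}`. -/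
def IsInvariant (M : ControlModel X A) (ϑ : Measure (X × A)) : Prop :=
  IsFiniteMeasure ϑ ∧ ϑ M.graphᶜ = 0 ∧ ϑ.fst = M.Q.restrict M.measurableSet_Δ.compl ∘ₘ ϑ

/-- A set of nonnegative measures is bounded when the total masses are. -/
def IsBoundedSet (S : Set (Measure (X × A))) : Prop :=
  ∃ c : ℝ≥0∞, c < ∞ ∧ ∀ μ ∈ S, μ Set.univ ≤ c

end ControlModel

namespace ControlModel

variable {X A : Type*} [MeasurableSpace X] [MeasurableSpace A]

/-! Let `m_t` be the law of `(X_t, A_t)` on `T_Δ > t` (`layer`), so that the occupation measure is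
`∑ₜ m_t`, of total mass `E[T_Δ]`. The marginals satisfy the forward equations `m_0^X = η|Δᶜ` and
`m_{t+1}^X = (m_t Q)|Δᶜ`; summing them gives the characteristic equations.

For (i), disintegrate a solution as `μ = μ^X ⊗ σ` with `σ` feasible. The map `ρ ↦ (η + ρQ)|Δᶜ ⊗ σ`
is monotone, fixes `μ`, and sends each partial sum of the layers of `σ` to the next, so `μ_{η,σ} ≤
μ` (`occupationMeasure_toPolicy_le`). The difference has the form `ν ⊗ σ` and solves the homogeneous
equations, hence is invariant.

For (ii), (a) ⇒ (b) is read off (i). For (b) ⇒ (c), the forward equations are linear and each of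
their feasible solutions comes from a Markov policy, so countable mixtures of occupation measures
are occupation measures; if masses were unbounded, a mixture would have infinite mass. For (c) ⇒
(a), adding multiples of a nonzero invariant measure to a solution gives solutions of unbounded
mass. -/

instance (M : ControlModel X A) (π : M.Policy) : IsProbabilityMeasure (M.initialLaw π) := by
  unfold initialLaw
  infer_instance

instance (M : ControlModel X A) (π : M.Policy) : IsProbabilityMeasure (M.pathLaw π) := by
  unfold pathLaw
  infer_instance

lemma measurableSet_graph' (M : ControlModel X A) : MeasurableSet M.graph :=
  M.measurableSet_graph

lemma measurableSet_act (M : ControlModel X A) (x : X) : MeasurableSet (M.act x) :=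
  measurable_prodMk_left M.measurableSet_graph

/-! ### Layers of the killed process and their forward equations -/

/-- The law of `(X_t, A_t)` on the event `T_Δ > t`. -/
noncomputable def layer (M : ControlModel X A) (π : M.Policy) (t : ℕ) : Measure (X × A) :=
  ((M.pathLaw π).restrict {ω | (t : ℕ∞) < M.hittingTime ω}).map (fun ω ↦ ω t)

lemma occupationMeasure_eq_sum_layer (M : ControlModel X A) (π : M.Policy) :
    M.occupationMeasure π = Measure.sum (M.layer π) := rfl

instance (M : ControlModel X A) (π : M.Policy) (t : ℕ) : IsFiniteMeasure (M.layer π t) := by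
  unfold layer
  infer_instance

/-- The set of state-action sequences up to time `t` which avoid `Δ`. -/
def survivors (M : ControlModel X A) (t : ℕ) : Set (Finset.Iic t → X × A) :=
  {h | ∀ i, (h i).1 ∉ M.Δ}

lemma measurableSet_survivors (M : ControlModel X A) (t : ℕ) :
    MeasurableSet (M.survivors t) := by
  simp only [survivors, Set.ofPred_forall]
  exact MeasurableSet.iInter fun i ↦
    (M.measurableSet_Δ.preimage (measurable_fst.comp (measurable_pi_apply i))).compl

/-- The law of the state-action pairs up to time `t` on the event `T_Δ > t`. -/
noncomputable def survivorLaw (M : ControlModel X A) (π : M.Policy) (t : ℕ) :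
    Measure (Finset.Iic t → X × A) :=
  ((M.pathLaw π).map (Preorder.frestrictLe (π := fun _ : ℕ ↦ X × A) t)).restrict (M.survivors t)

lemma preimage_survivors (M : ControlModel X A) (t : ℕ) :
    Preorder.frestrictLe (π := fun _ : ℕ ↦ X × A) t ⁻¹' M.survivors t =
      {ω | (t : ℕ∞) < M.hittingTime ω} := by
  ext ω
  simp only [Set.mem_preimage, survivors, Set.mem_ofPred_eq, lt_hittingTime_iff]
  exact ⟨fun h n hn ↦ h ⟨n, Finset.mem_Iic.2 hn⟩, fun h i ↦ h i (Finset.mem_Iic.1 i.2)⟩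

lemma layer_eq_map_survivorLaw (M : ControlModel X A) (π : M.Policy) (t : ℕ) :
    M.layer π t = (M.survivorLaw π t).map (fun h ↦ h ⟨t, Finset.mem_Iic.2 le_rfl⟩) := by
  have hm : Measurable (Preorder.frestrictLe (π := fun _ : ℕ ↦ X × A) t) := by fun_prop
  rw [survivorLaw, Measure.restrict_map hm (M.measurableSet_survivors t), M.preimage_survivors,
    Measure.map_map (measurable_pi_apply _) hm]
  rfl

/-- Condition on the path up to time `t`: surviving past `t + 1` means surviving past `t` and then
`X_{t+1} ∉ Δ`. The whole surviving path is kept because a policy may depend on all of it. -/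
lemma layer_succ_apply (M : ControlModel X A) (π : M.Policy) (t : ℕ) {Γ : Set (X × A)}
    (hΓ : MeasurableSet Γ) :
    M.layer π (t + 1) Γ =
      ∫⁻ h, M.stepKernel π t h (Γ ∩ Prod.fst ⁻¹' M.Δᶜ) ∂(M.survivorLaw π t) := by
  have hΔ : MeasurableSet (Prod.fst ⁻¹' M.Δᶜ : Set (X × A)) :=
    measurable_fst M.measurableSet_Δ.compl
  have hE := M.measurableSet_survivors t
  have hset : MeasurableSet (M.survivors t ×ˢ (Γ ∩ Prod.fst ⁻¹' M.Δᶜ)) :=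
    hE.prod (hΓ.inter hΔ)
  have key := congrArg (fun m ↦ m (M.survivors t ×ˢ (Γ ∩ Prod.fst ⁻¹' M.Δᶜ)))
    (Kernel.map_frestrictLe_trajMeasure_compProd_eq_map_trajMeasure (X := fun _ ↦ X × A)
      (μ₀ := M.initialLaw π) (κ := M.stepKernel π) (a := t))
  have : IsProbabilityMeasure ((M.pathLaw π).map
      (Preorder.frestrictLe (π := fun _ : ℕ ↦ X × A) t)) :=
    Measure.isProbabilityMeasure_map (by fun_prop)
  have key' : ((M.pathLaw π).map (Preorder.frestrictLe (π := fun _ : ℕ ↦ X × A) t) ⊗ₘ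
      M.stepKernel π t) (M.survivors t ×ˢ (Γ ∩ Prod.fst ⁻¹' M.Δᶜ)) = _ := key
  rw [Measure.compProd_apply_prod hE (hΓ.inter hΔ)] at key'
  rw [survivorLaw, key', Measure.map_apply (by fun_prop) hset, layer,
    Measure.map_apply (by fun_prop) hΓ,
    Measure.restrict_apply (hΓ.preimage (by fun_prop))]
  change M.pathLaw π _ = M.pathLaw π _
  congr 1
  ext ω
  have h1 := Set.ext_iff.1 (M.preimage_survivors t) ω
  simp only [Set.mem_preimage, Set.mem_ofPred_eq, lt_hittingTime_iff] at h1
  simp only [Set.mem_inter_iff, Set.mem_preimage, Set.mem_prod, Set.mem_ofPred_eq,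
    lt_hittingTime_iff, h1, Nat.le_succ_iff, Set.mem_compl_iff]
  constructor
  · rintro ⟨h, h'⟩
    exact ⟨fun n hn ↦ h' n (Or.inl hn), h, h' _ (Or.inr rfl)⟩
  · rintro ⟨h, h', h''⟩
    exact ⟨h', fun n hn ↦ hn.elim (h n) (by rintro rfl; exact h'')⟩

lemma map_eval_zero_pathLaw (M : ControlModel X A) (π : M.Policy) :
    (M.pathLaw π).map (fun ω ↦ ω 0) = M.initialLaw π := by
  let e := MeasurableEquiv.piUnique (fun _ : Finset.Iic 0 ↦ X × A)
  have hm : Measurable (Preorder.frestrictLe (π := fun _ : ℕ ↦ X × A) 0) := by fun_prop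
  have h1 : (M.pathLaw π).map (Preorder.frestrictLe (π := fun _ : ℕ ↦ X × A) 0) =
      (M.initialLaw π).map e.symm := by
    rw [pathLaw, Kernel.trajMeasure, Measure.map_comp _ _ hm, Kernel.traj_map_frestrictLe,
      Kernel.partialTraj_self, Measure.id_comp]
  calc (M.pathLaw π).map (fun ω ↦ ω 0)
      = ((M.pathLaw π).map (Preorder.frestrictLe (π := fun _ : ℕ ↦ X × A) 0)).map e := by
        rw [Measure.map_map e.measurable hm]; rfl
    _ = M.initialLaw π := by
        rw [h1, Measure.map_map e.measurable e.symm.measurable]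
        simp

lemma layer_zero (M : ControlModel X A) (π : M.Policy) :
    M.layer π 0 = (M.initialLaw π).restrict (Prod.fst ⁻¹' M.Δᶜ) := by
  have hΔ : MeasurableSet (Prod.fst ⁻¹' M.Δᶜ : Set (X × A)) :=
    measurable_fst M.measurableSet_Δ.compl
  rw [← M.map_eval_zero_pathLaw π, Measure.restrict_map (measurable_pi_apply 0) hΔ, layer]
  congr 2
  ext ω
  simpa using M.lt_hittingTime_iff 0 ω

lemma lintegral_survivorLaw_eval (M : ControlModel X A) (π : M.Policy) (t : ℕ)
    {f : X × A → ℝ≥0∞} (hf : Measurable f) :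
    ∫⁻ h, f (h ⟨t, Finset.mem_Iic.2 le_rfl⟩) ∂(M.survivorLaw π t) = ∫⁻ y, f y ∂(M.layer π t) := by
  rw [layer_eq_map_survivorLaw, lintegral_map hf (measurable_pi_apply _)]

lemma fst_layer_zero (M : ControlModel X A) (π : M.Policy) :
    (M.layer π 0).fst = M.η.restrict M.Δᶜ := by
  rw [layer_zero, Measure.fst, ← Measure.restrict_map measurable_fst M.measurableSet_Δ.compl,
    initialLaw]
  congr 1
  exact Measure.fst_compProd _ _

lemma stepKernel_apply (M : ControlModel X A) (π : M.Policy) (t : ℕ)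
    (h : Finset.Iic t → X × A) {Γ : Set (X × A)} (hΓ : MeasurableSet Γ) :
    M.stepKernel π t h Γ = ∫⁻ x, π.kernel (t + 1) (toHist t (h, x)) (Prod.mk x ⁻¹' Γ)
      ∂(M.Q (h ⟨t, Finset.mem_Iic.2 le_rfl⟩)) := by
  rw [stepKernel, Kernel.compProd_apply hΓ]
  rfl

/-- The choice of `A_{t+1}` integrates out of the state marginal, and what remains of the past is
only `(X_t, A_t)`; hence the recursion closes on layers even for history-dependent policies. -/
lemma fst_layer_succ (M : ControlModel X A) (π : M.Policy) (t : ℕ) :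
    (M.layer π (t + 1)).fst = (M.Q ∘ₘ M.layer π t).restrict M.Δᶜ := by
  ext B hB
  have hB' := hB.inter M.measurableSet_Δ.compl
  rw [Measure.fst_apply hB, layer_succ_apply _ _ _ (measurable_fst hB), Measure.restrict_apply hB,
    Measure.bind_apply hB' M.Q.aemeasurable, ← lintegral_survivorLaw_eval _ _ _ (M.Q.measurable_coe hB')]
  refine lintegral_congr fun h ↦ ?_
  rw [← Set.preimage_inter, stepKernel_apply _ _ _ _ (measurable_fst hB'),
    ← lintegral_indicator_one hB']
  refine lintegral_congr fun x ↦ ?_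
  by_cases hx : x ∈ B ∩ M.Δᶜ
  · rw [Set.indicator_of_mem hx, ← Set.preimage_comp]
    have : (Prod.fst ∘ Prod.mk x : A → X) ⁻¹' (B ∩ M.Δᶜ) = Set.univ := by
      ext; simpa using hx
    rw [this]
    simp
  · rw [Set.indicator_of_notMem hx, ← Set.preimage_comp]
    have : (Prod.fst ∘ Prod.mk x : A → X) ⁻¹' (B ∩ M.Δᶜ) = ∅ := by
      ext; simpa using hx
    rw [this]
    simp

lemma Policy.kernel_compl_act {M : ControlModel X A} (π : M.Policy) (n : ℕ) (h : Hist X A n) :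
    π.kernel n h (M.act h.2)ᶜ = 0 :=
  (prob_compl_eq_zero_iff (M.measurableSet_act _)).2 (π.feasible n h)

lemma FeasibleKernel.kernel_compl_act {M : ControlModel X A} (σ : M.FeasibleKernel) (x : X) :
    σ.kernel x (M.act x)ᶜ = 0 :=
  (prob_compl_eq_zero_iff (M.measurableSet_act _)).2 (σ.feasible x)

lemma layer_compl_graph (M : ControlModel X A) (π : M.Policy) (t : ℕ) :
    M.layer π t M.graphᶜ = 0 := by
  have hg := M.measurableSet_graph'.compl
  cases t with
  | zero =>
    rw [layer_zero]
    refine le_antisymm ((Measure.restrict_apply_le _ _).trans ?_) zero_le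
    rw [initialLaw, Measure.compProd_apply hg, nonpos_iff_eq_zero]
    exact lintegral_eq_zero_of_ae_eq_zero (.of_forall fun x ↦ π.kernel_compl_act 0 _)
  | succ t =>
    have h0 (h : Finset.Iic t → X × A) : M.stepKernel π t h M.graphᶜ = 0 := by
      rw [stepKernel_apply _ _ _ _ hg]
      exact lintegral_eq_zero_of_ae_eq_zero (.of_forall fun x ↦ π.kernel_compl_act (t + 1) _)
    rw [layer_succ_apply _ _ _ hg]
    exact lintegral_eq_zero_of_ae_eq_zero
      (.of_forall fun h ↦ measure_mono_null Set.inter_subset_left (h0 h))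

/-! ### Markov policies -/

/-- The Markov policy `π_n(·|h_n) = φ_n(·|x_n)`. -/
def markovPolicy {M : ControlModel X A} (φ : ℕ → M.FeasibleKernel) : M.Policy where
  kernel n := (φ n).kernel.comap Prod.snd measurable_snd
  isMarkovKernel _ := inferInstance
  feasible n h := (φ n).feasible h.2

/-- Survival past `t` is decided by the states up to `X_t`, before `A_t` is drawn from `φ_t(·|X_t)`,
so killing does not disturb the disintegration. Together with the forward equations this determines
all layers recursively. -/
lemma layer_markovPolicy (M : ControlModel X A) (φ : ℕ → M.FeasibleKernel) (t : ℕ) :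
    M.layer (markovPolicy φ) t = (M.layer (markovPolicy φ) t).fst ⊗ₘ (φ t).kernel := by
  have hΔ := M.measurableSet_Δ.compl
  have hΔ' : MeasurableSet (Prod.fst ⁻¹' M.Δᶜ : Set (X × A)) := measurable_fst hΔ
  cases t with
  | zero =>
    rw [fst_layer_zero, layer_zero]
    ext Γ hΓ
    rw [Measure.restrict_apply hΓ, initialLaw, Measure.compProd_apply (hΓ.inter hΔ'),
      Measure.compProd_apply hΓ, ← lintegral_indicator hΔ]
    refine lintegral_congr fun x ↦ ?_
    by_cases hx : x ∈ M.Δ <;> simp [hx, Set.preimage_inter, ← Set.preimage_comp,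
      Function.comp_def, markovPolicy]
  | succ t =>
    ext Γ hΓ
    have hf : Measurable fun x ↦ (φ (t + 1)).kernel x (Prod.mk x ⁻¹' Γ) :=
      Kernel.measurable_kernel_prodMk_left hΓ
    rw [layer_succ_apply _ _ _ hΓ, fst_layer_succ, Measure.compProd_apply hΓ,
      ← lintegral_indicator hΔ, Measure.lintegral_bind M.Q.aemeasurable
        (hf.indicator hΔ).aemeasurable,
      ← lintegral_survivorLaw_eval _ _ _ (hf.indicator hΔ).lintegral_kernel]
    refine lintegral_congr fun h ↦ ?_
    rw [stepKernel_apply _ _ _ _ (hΓ.inter hΔ')]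
    refine lintegral_congr fun x ↦ ?_
    by_cases hx : x ∈ M.Δ <;> simp [hx, Set.preimage_inter, ← Set.preimage_comp,
      Function.comp_def, markovPolicy, toHist]

/-! ### Total mass as expected hitting time -/

lemma tsum_indicator_lt (T : ℕ∞) :
    ∑' t : ℕ, {s : ℕ∞ | s < T}.indicator (fun _ ↦ (1 : ℝ≥0∞)) t = T := by
  induction T using ENat.recTopCoe with
  | top => simp [Set.indicator]
  | coe n =>
    rw [tsum_eq_sum (s := Finset.range n)]
    · rw [Finset.sum_congr rfl (g := fun _ ↦ 1)]
      · simp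
      · intro t ht
        simpa using ht
    · intro t ht
      simpa using ht

lemma occupationMeasure_univ (M : ControlModel X A) (π : M.Policy) :
    M.occupationMeasure π Set.univ = ∫⁻ ω, (M.hittingTime ω : ℝ≥0∞) ∂(M.pathLaw π) := by
  rw [occupationMeasure_apply _ _ MeasurableSet.univ]
  refine lintegral_congr fun ω ↦ ?_
  rw [← tsum_indicator_lt]
  exact tsum_congr fun t ↦ by simp [Set.indicator]

lemma IsAbsorbing.isFiniteMeasure_occupationMeasure {M : ControlModel X A} (h : M.IsAbsorbing)
    (π : M.Policy) : IsFiniteMeasure (M.occupationMeasure π) :=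
  ⟨by rw [occupationMeasure_univ]; exact h.2 π⟩

/-! ### Measure-theoretic preliminaries -/

/-- A measure is determined by its sum with a finite measure. -/
lemma _root_.MeasureTheory.Measure.eq_of_add_left_eq {α : Type*} [MeasurableSpace α]
    {μ ν ρ : Measure α} [IsFiniteMeasure μ] (h : μ + ν = μ + ρ) : ν = ρ := by
  ext s hs
  have := congrArg (fun m ↦ m s) h
  simp only [Measure.add_apply] at this
  exact (ENNReal.add_right_inj (measure_ne_top μ s)).1 this

lemma _root_.MeasureTheory.Measure.bind_sum_left {α β ι : Type*} [MeasurableSpace α]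
    [MeasurableSpace β] (m : ι → Measure α) (κ : Kernel α β) :
    κ ∘ₘ Measure.sum m = Measure.sum fun i ↦ κ ∘ₘ m i := by
  ext s hs
  rw [Measure.bind_apply hs κ.aemeasurable, lintegral_sum_measure, Measure.sum_apply _ hs]
  exact tsum_congr fun i ↦ (Measure.bind_apply hs κ.aemeasurable).symm

lemma _root_.MeasureTheory.Measure.fst_sum_measure {α β ι : Type*} [MeasurableSpace α]
    [MeasurableSpace β] (m : ι → Measure (α × β)) :
    (Measure.sum m).fst = Measure.sum fun i ↦ (m i).fst :=
  Measure.map_sum measurable_fst.aemeasurable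

lemma _root_.MeasureTheory.Measure.compProd_mono_left {α β : Type*} [MeasurableSpace α]
    [MeasurableSpace β] {μ ν : Measure α} [SFinite μ] [SFinite ν] (h : μ ≤ ν) (κ : Kernel α β)
    [IsSFiniteKernel κ] : μ ⊗ₘ κ ≤ ν ⊗ₘ κ := by
  refine Measure.le_iff.2 fun s hs ↦ ?_
  rw [Measure.compProd_apply hs, Measure.compProd_apply hs]
  exact lintegral_mono' h le_rfl

lemma _root_.MeasureTheory.Measure.bind_mono_left {α β : Type*} [MeasurableSpace α]
    [MeasurableSpace β] {μ ν : Measure α} (h : μ ≤ ν) (κ : Kernel α β) : κ ∘ₘ μ ≤ κ ∘ₘ ν := by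
  refine Measure.le_iff.2 fun s hs ↦ ?_
  rw [Measure.bind_apply hs κ.aemeasurable, Measure.bind_apply hs κ.aemeasurable]
  exact lintegral_mono' h le_rfl

lemma _root_.MeasureTheory.Measure.restrict_bind {α β : Type*} [MeasurableSpace α]
    [MeasurableSpace β] (μ : Measure α) (κ : Kernel α β) {s : Set β} (hs : MeasurableSet s) :
    κ.restrict hs ∘ₘ μ = (κ ∘ₘ μ).restrict s := by
  ext t ht
  rw [Measure.bind_apply ht (Kernel.aemeasurable _), Measure.restrict_apply ht,
    Measure.bind_apply (ht.inter hs) κ.aemeasurable]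
  exact lintegral_congr fun a ↦ Kernel.restrict_apply' _ _ _ ht

/-! ### Characteristic equations and invariant measures -/

lemma isInvariant_iff (M : ControlModel X A) (ϑ : Measure (X × A)) :
    M.IsInvariant ϑ ↔
      IsFiniteMeasure ϑ ∧ ϑ M.graphᶜ = 0 ∧ ϑ.fst = (M.Q ∘ₘ ϑ).restrict M.Δᶜ := by
  rw [IsInvariant, Measure.restrict_bind]

lemma nonempty_actions (M : ControlModel X A) : Nonempty A := by
  have : Nonempty X := nonempty_of_isProbabilityMeasure M.η
  exact ⟨(M.act_nonempty (Classical.arbitrary X)).some⟩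

lemma occupationMeasure_compl_graph (M : ControlModel X A) (π : M.Policy) :
    M.occupationMeasure π M.graphᶜ = 0 := by
  rw [occupationMeasure_eq_sum_layer, Measure.sum_apply _ M.measurableSet_graph'.compl]
  simp [layer_compl_graph]

/-- Truncated characteristic equation: `n + 1` layers on the left against `n` on the right, which
drives the induction for minimality. -/
lemma fst_sum_range_succ_layer (M : ControlModel X A) (π : M.Policy) (n : ℕ) :
    (∑ t ∈ Finset.range (n + 1), M.layer π t).fst =
      (M.η + M.Q ∘ₘ (∑ t ∈ Finset.range n, M.layer π t)).restrict M.Δᶜ := by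
  induction n with
  | zero => simp [fst_layer_zero]
  | succ n ih =>
    rw [Finset.sum_range_succ, Measure.fst_add, ih, fst_layer_succ, Finset.sum_range_succ _ n,
      Measure.comp_add, Measure.restrict_add, Measure.restrict_add, Measure.restrict_add, add_assoc]

lemma fst_occupationMeasure (M : ControlModel X A) (π : M.Policy) :
    (M.occupationMeasure π).fst = (M.η + M.Q ∘ₘ M.occupationMeasure π).restrict M.Δᶜ := by
  rw [occupationMeasure_eq_sum_layer, Measure.fst_sum_measure, Measure.bind_sum_left,
    Measure.restrict_add, Measure.restrict_sum _ M.measurableSet_Δ.compl]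
  ext B hB
  -- The term `t = 0` yields `η|Δᶜ`; the shifted tail yields the part coming from `Q`.
  rw [Measure.sum_apply _ hB, tsum_eq_zero_add' ENNReal.summable, Measure.add_apply,
    Measure.sum_apply _ hB, fst_layer_zero]
  simp only [fst_layer_succ]

lemma IsAbsorbing.occupationMeasure_mem_charSolutions {M : ControlModel X A} (h : M.IsAbsorbing)
    (π : M.Policy) : M.occupationMeasure π ∈ M.charSolutions :=
  ⟨h.isFiniteMeasure_occupationMeasure π, M.occupationMeasure_compl_graph π,
    M.fst_occupationMeasure π⟩

lemma add_mem_charSolutions {M : ControlModel X A} {μ ϑ : Measure (X × A)}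
    (hμ : μ ∈ M.charSolutions) (hϑ : M.IsInvariant ϑ) : μ + ϑ ∈ M.charSolutions := by
  rw [isInvariant_iff] at hϑ
  obtain ⟨h1, h2, h3⟩ := hμ
  obtain ⟨k1, k2, k3⟩ := hϑ
  refine ⟨inferInstance, by simp [h2, k2], ?_⟩
  rw [Measure.fst_add, h3, k3, Measure.comp_add, ← add_assoc, ← Measure.restrict_add]

lemma IsInvariant.natCast_smul {M : ControlModel X A} {ϑ : Measure (X × A)}
    (hϑ : M.IsInvariant ϑ) (n : ℕ) : M.IsInvariant ((n : ℝ≥0∞) • ϑ) := by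
  rw [isInvariant_iff] at hϑ ⊢
  obtain ⟨k1, k2, k3⟩ := hϑ
  refine ⟨⟨?_⟩, by simp [k2], ?_⟩
  · simpa using ENNReal.mul_lt_top (ENNReal.natCast_lt_top n) (measure_lt_top ϑ _)
  · rw [Measure.comp_smul, Measure.restrict_smul, ← k3]
    exact Measure.map_smul ..

/-! ### Disintegration, minimality and part (i) -/

/-- A finite measure on the feasible pairs disintegrates along a feasible kernel. -/
lemma FeasibleKernel.exists_eq_fst_compProd [StandardBorelSpace A] {M : ControlModel X A}
    (σ₀ : M.FeasibleKernel) (m : Measure (X × A)) [IsFiniteMeasure m] (hm : m M.graphᶜ = 0) :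
    ∃ σ : M.FeasibleKernel, m.fst ⊗ₘ σ.kernel = m := by
  classical
  have := M.nonempty_actions
  have hd : m.fst ⊗ₘ m.condKernel = m := m.disintegrate m.condKernel
  have hS : MeasurableSet {x | m.condKernel x (M.act x) = 1} :=
    (Kernel.measurable_kernel_prodMk_left (κ := m.condKernel) M.measurableSet_graph)
      (measurableSet_singleton 1)
  -- The conditional kernel is feasible only almost everywhere, so `σ₀` replaces it on the
  -- exceptional states.
  refine ⟨⟨Kernel.piecewise hS m.condKernel σ₀.kernel, inferInstance, fun x ↦ ?_⟩, ?_⟩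
  · rw [Kernel.piecewise_apply]
    split_ifs with h
    · exact h
    · exact σ₀.feasible x
  · conv_rhs => rw [← hd]
    refine Measure.compProd_congr ?_
    have h0 : ∀ᵐ p ∂(m.fst ⊗ₘ m.condKernel), p ∈ M.graph := by
      rw [hd]
      exact hm
    filter_upwards [Measure.ae_ae_of_ae_compProd h0] with x hx
    have hx' : m.condKernel x (M.act x) = 1 := prob_compl_eq_zero_iff (M.measurableSet_act x) |>.1 hx
    rw [Kernel.piecewise_apply]
    exact if_pos hx'

lemma occupationMeasure_toPolicy_compProd (M : ControlModel X A) (σ : M.FeasibleKernel) :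
    (M.occupationMeasure σ.toPolicy).fst ⊗ₘ σ.kernel = M.occupationMeasure σ.toPolicy := by
  rw [occupationMeasure_eq_sum_layer, Measure.fst_sum_measure, Measure.compProd_sum_left]
  congr 1 with t : 1
  exact (M.layer_markovPolicy (fun _ ↦ σ) t).symm

/-- The occupation measure of a stationary policy is the smallest solution of the characteristic
equations which disintegrates along the kernel of that policy. -/
lemma occupationMeasure_toPolicy_le {M : ControlModel X A} {μ : Measure (X × A)}
    (hμ : μ ∈ M.charSolutions) (σ : M.FeasibleKernel) (hσ : μ.fst ⊗ₘ σ.kernel = μ) :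
    M.occupationMeasure σ.toPolicy ≤ μ := by
  have := hμ.1
  have hle (n : ℕ) : ∑ t ∈ Finset.range n, M.layer σ.toPolicy t ≤ μ := by
    induction n with
    | zero => simpa using Measure.zero_le μ
    | succ n ih =>
      have hcomp : ∑ t ∈ Finset.range (n + 1), M.layer σ.toPolicy t =
          (∑ t ∈ Finset.range (n + 1), M.layer σ.toPolicy t).fst ⊗ₘ σ.kernel := by
        induction n + 1 with
        | zero => simp
        | succ k ihk =>
          rw [Finset.sum_range_succ, Measure.fst_add, Measure.compProd_add_left, ← ihk]
          congr 1
          exact M.layer_markovPolicy (fun _ ↦ σ) k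
      rw [hcomp, ← hσ]
      -- Both sides now disintegrate along `σ`, so comparing marginals suffices.
      refine Measure.compProd_mono_left ?_ _
      rw [fst_sum_range_succ_layer, hμ.2.2]
      exact Measure.restrict_mono le_rfl (add_le_add le_rfl (Measure.bind_mono_left ih _))
  refine Measure.le_iff.2 fun Γ hΓ ↦ ?_
  rw [occupationMeasure_eq_sum_layer, Measure.sum_apply _ hΓ, ENNReal.tsum_eq_iSup_nat]
  refine iSup_le fun n ↦ ?_
  have := hle n Γ
  rwa [Measure.finsetSum_apply] at this

lemma mem_charSolutions_iff [StandardBorelSpace A] {M : ControlModel X A}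
    (hne : Nonempty M.FeasibleKernel) (habs : M.IsAbsorbing) (μ : Measure (X × A)) :
    μ ∈ M.charSolutions ↔ ∃ (σ : M.FeasibleKernel) (ν : Measure X), IsFiniteMeasure ν ∧
      M.IsInvariant (ν ⊗ₘ σ.kernel) ∧
      μ = M.occupationMeasure σ.toPolicy + ν ⊗ₘ σ.kernel := by
  constructor
  · intro hμ
    have := hμ.1
    obtain ⟨σ, hσ⟩ := hne.some.exists_eq_fst_compProd μ hμ.2.1
    have hocc := habs.occupationMeasure_mem_charSolutions σ.toPolicy
    set o := M.occupationMeasure σ.toPolicy with ho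
    have := hocc.1
    have hle : o.fst ≤ μ.fst :=
      Measure.map_mono (occupationMeasure_toPolicy_le hμ σ hσ) measurable_fst
    obtain ⟨ν, hfin, hν⟩ : ∃ ν : Measure X, IsFiniteMeasure ν ∧ o.fst + ν = μ.fst :=
      ⟨μ.fst - o.fst, inferInstance, by rw [add_comm, Measure.sub_add_cancel_of_le hle]⟩
    have hdec : μ = o + ν ⊗ₘ σ.kernel := by
      conv_lhs => rw [← hσ, ← hν, Measure.compProd_add_left]
      rw [ho, occupationMeasure_toPolicy_compProd]
    refine ⟨σ, ν, hfin, ?_, hdec⟩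
    rw [isInvariant_iff]
    refine ⟨inferInstance, ?_, ?_⟩
    · rw [Measure.compProd_apply M.measurableSet_graph'.compl]
      exact lintegral_eq_zero_of_ae_eq_zero (.of_forall fun x ↦ σ.kernel_compl_act x)
    -- Invariance is the difference of the characteristic equations of `μ` and `o`; the finite
    -- measure `o.fst` can be cancelled.
    · refine Measure.eq_of_add_left_eq (μ := o.fst) ?_
      rw [Measure.fst_compProd, hν, hμ.2.2]
      conv_lhs => rw [hdec]
      rw [Measure.comp_add, ← add_assoc, Measure.restrict_add, ← hocc.2.2]
  · rintro ⟨σ, ν, -, hinv, rfl⟩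
    exact add_mem_charSolutions (habs.occupationMeasure_mem_charSolutions _) hinv

/-! ### Mixtures of policies and the uniform bound -/

/-- A sequence of finite measures on the feasible pairs whose marginals satisfy the forward
equations is the sequence of layers of a Markov policy. -/
lemma exists_markovPolicy_layer_eq [StandardBorelSpace A] {M : ControlModel X A}
    (hne : Nonempty M.FeasibleKernel) (m : ℕ → Measure (X × A)) [∀ t, IsFiniteMeasure (m t)]
    (hK : ∀ t, m t M.graphᶜ = 0) (h0 : (m 0).fst = M.η.restrict M.Δᶜ)
    (hs : ∀ t, (m (t + 1)).fst = (M.Q ∘ₘ m t).restrict M.Δᶜ) :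
    ∃ φ : ℕ → M.FeasibleKernel, ∀ t, M.layer (markovPolicy φ) t = m t := by
  choose φ hφ using fun t ↦ hne.some.exists_eq_fst_compProd (m t) (hK t)
  refine ⟨φ, fun t ↦ ?_⟩
  induction t with
  | zero => rw [layer_markovPolicy, fst_layer_zero, ← h0, hφ]
  | succ t ih => rw [layer_markovPolicy, fst_layer_succ, ih, ← hs, hφ]

/-- Countable convex combinations of occupation measures are occupation measures. -/
lemma sum_smul_mem_occupationMeasures [StandardBorelSpace A] {M : ControlModel X A}
    (hne : Nonempty M.FeasibleKernel) (π : ℕ → M.Policy) (w : ℕ → ℝ≥0∞) (hw : ∑' k, w k = 1) :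
    Measure.sum (fun k ↦ w k • M.occupationMeasure (π k)) ∈ M.occupationMeasures := by
  let m (t : ℕ) : Measure (X × A) := Measure.sum fun k ↦ w k • M.layer (π k) t
  have hfin (t : ℕ) : IsFiniteMeasure (m t) := by
    refine ⟨?_⟩
    rw [Measure.sum_apply _ MeasurableSet.univ]
    refine lt_of_le_of_lt (ENNReal.tsum_le_tsum (g := w) fun k ↦ ?_) (by simp [hw])
    have : M.layer (π k) t Set.univ ≤ 1 := by
      rw [layer, Measure.map_apply (by fun_prop) MeasurableSet.univ]
      exact (Measure.restrict_apply_le _ _).trans prob_le_one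
    simpa using mul_le_mul_right this (w k)
  have hfst (t : ℕ) : (m t).fst = Measure.sum fun k ↦ w k • (M.layer (π k) t).fst := by
    rw [Measure.fst_sum_measure]
    congr 1 with k : 1
    exact Measure.map_smul ..
  -- The mixed layers inherit the forward equations by linearity; `∑ w k = 1` preserves the initial
  -- condition.
  obtain ⟨φ, hφ⟩ := exists_markovPolicy_layer_eq hne m
    (fun t ↦ by
      rw [Measure.sum_apply _ M.measurableSet_graph'.compl]
      simp [layer_compl_graph])
    (by
      rw [hfst]
      ext B hB
      simp [Measure.sum_apply _ hB, fst_layer_zero, ENNReal.tsum_mul_right, hw])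
    (fun t ↦ by
      rw [hfst, Measure.bind_sum_left, Measure.restrict_sum _ M.measurableSet_Δ.compl]
      congr 1 with k : 1
      rw [fst_layer_succ, Measure.comp_smul, Measure.restrict_smul])
  refine ⟨markovPolicy φ, ?_⟩
  ext Γ hΓ
  simp only [occupationMeasure_eq_sum_layer, Measure.sum_apply _ hΓ, hφ, m, Measure.smul_apply,
    smul_eq_mul, ← ENNReal.tsum_mul_left]
  exact ENNReal.tsum_comm

/-- In an absorbing model, the expected hitting times are uniformly bounded over all policies. -/
lemma IsAbsorbing.isBoundedSet_occupationMeasures [StandardBorelSpace A] {M : ControlModel X A}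
    (hne : Nonempty M.FeasibleKernel) (habs : M.IsAbsorbing) :
    IsBoundedSet M.occupationMeasures := by
  by_contra hb
  have hbig (k : ℕ) : ∃ π : M.Policy, (2 : ℝ≥0∞) ^ (k + 1) ≤ M.occupationMeasure π Set.univ := by
    by_contra! hc
    refine hb ⟨2 ^ (k + 1), by finiteness, ?_⟩
    rintro _ ⟨π, rfl⟩
    exact (hc π).le
  choose π hπ using hbig
  have hw : ∑' k : ℕ, ((2 : ℝ≥0∞) ^ (k + 1))⁻¹ = 1 := by
    simp only [ENNReal.inv_pow]
    rw [ENNReal.tsum_geometric_add_one, ENNReal.one_sub_inv_two, inv_inv]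
    exact ENNReal.inv_mul_cancel (by simp) (by simp)
  obtain ⟨ρ, hρ⟩ := sum_smul_mem_occupationMeasures hne π _ hw
  have hfin := habs.isFiniteMeasure_occupationMeasure ρ
  refine (measure_lt_top (M.occupationMeasure ρ) Set.univ).ne (top_le_iff.1 ?_)
  rw [hρ, Measure.sum_apply _ MeasurableSet.univ]
  -- Each weight `2^{-(k+1)}` meets a mass of at least `2^{k+1}`, so every term contributes at least
  -- `1`.
  calc (⊤ : ℝ≥0∞) = ∑' _ : ℕ, 1 := by simp
    _ ≤ _ := ENNReal.tsum_le_tsum fun k ↦ ?_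
  calc (1 : ℝ≥0∞) = (2 ^ (k + 1))⁻¹ * 2 ^ (k + 1) :=
        (ENNReal.inv_mul_cancel (by simp) (by finiteness)).symm
    _ ≤ _ := mul_le_mul_right (hπ k) _

/-! ### Boundedness excludes nonzero invariant measures -/

lemma isInvariant_zero (M : ControlModel X A) : M.IsInvariant 0 := by
  rw [isInvariant_iff]
  exact ⟨inferInstance, by simp, by simp⟩

/-- If the solutions of the characteristic equations are bounded, an invariant measure is null. -/
lemma IsInvariant.eq_zero_of_isBoundedSet {M : ControlModel X A} {μ ϑ : Measure (X × A)}
    (hϑ : M.IsInvariant ϑ) (hμ : μ ∈ M.charSolutions) (hb : IsBoundedSet M.charSolutions) :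
    ϑ = 0 := by
  obtain ⟨c, hc, hle⟩ := hb
  by_contra h0
  have hpos : ϑ Set.univ ≠ 0 := by simpa using h0
  obtain ⟨n, hn⟩ := ENNReal.exists_nat_mul_gt hpos hc.ne
  refine (hn.trans_le ?_).false
  refine le_trans ?_ (hle _ (add_mem_charSolutions hμ (hϑ.natCast_smul n)))
  simp

end ControlModel

theorem theorem3p6 {X A : Type*} [MeasurableSpace X] [MeasurableSpace A] [StandardBorelSpace A]
    (M : ControlModel X A) (hne : Nonempty M.FeasibleKernel) (habs : M.IsAbsorbing) :
    (∀ μ : Measure (X × A), μ ∈ M.charSolutions ↔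
      ∃ (σ : M.FeasibleKernel) (ν : Measure X), IsFiniteMeasure ν ∧
        M.IsInvariant (ν ⊗ₘ σ.kernel) ∧
        μ = M.occupationMeasure σ.toPolicy + ν ⊗ₘ σ.kernel) ∧
    List.TFAE [
      {ϑ : Measure (X × A) | M.IsInvariant ϑ} = {0},
      M.charSolutions = M.occupationMeasures,
      ControlModel.IsBoundedSet M.charSolutions] := by
  refine ⟨ControlModel.mem_charSolutions_iff hne habs, ?_⟩
  tfae_have 1 → 2 := by
    intro h
    refine Set.Subset.antisymm (fun μ hμ ↦ ?_) ?_
    · obtain ⟨σ, ν, -, hinv, rfl⟩ := (ControlModel.mem_charSolutions_iff hne habs μ).1 hμ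
      have h0 : ν ⊗ₘ σ.kernel = 0 := (Set.ext_iff.1 h _).1 hinv
      exact ⟨σ.toPolicy, by rw [h0, add_zero]⟩
    · rintro _ ⟨π, rfl⟩
      exact habs.occupationMeasure_mem_charSolutions π
  tfae_have 2 → 3 := fun h ↦ h ▸ habs.isBoundedSet_occupationMeasures hne
  tfae_have 3 → 1 := by
    refine fun hb ↦ Set.Subset.antisymm (fun ϑ hϑ ↦ ?_) ?_
    · exact ControlModel.IsInvariant.eq_zero_of_isBoundedSet hϑ
        (habs.occupationMeasure_mem_charSolutions hne.some.toPolicy) hb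
    · rintro _ rfl
      exact M.isInvariant_zero
  tfae_finish
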